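/- Let $\mathcal S$ be a stabilizer on $n$ qubits, i.e. an abelian subgroup of the $n$-qubit Pauli group $\{\alpha R_1\otimes\cdots\otimes R_n : \alpha\in\{\pm1,\pm i\},\ R_j\in\{I,X,Y,Z\}\}$ with $-I\notin\mathcal S$, and let $|\mathcal S|=2^{n-k}$. Let $$Q=\{|\psi\rangle\in(\mathbb C^2)^{\otimes n} : R|\psi\rangle=|\psi\rangle\ \text{for all } R\in\mathcal S\}$$ be its stabilizer code, with $k$ logical qubits, and let $P_Q$ be the orthogonal projector onto $Q$. Assume that $Q$ is free of trivially encoded qubits: for each coordinate $j$ there is an element of $\mathcal S$ whose $j$-th tensor factor is not the identity. A unitary $U$ is a logical operation on $Q$ if $[U,P_Q]=0$; the logical gates on $Q$ are those in $SU(2^n)$. The full automorphism group $\mathrm{Aut}(Q)$ consists of all logical operations on $Q$ of the form $P_\pi(U_1\otimes\cdots\otimes U_n)$, where the $U_j$ are one-qubit unitaries and $P_\pi|\psi_1\cdots\psi_n\rangle=|\psi_{\pi(1)}\cdots\psi_{\pi(n)}\rangle$ enacts a permutation $\pi$ of the $n$ coordinates (global phases are not normalized). Choose any logical Pauli operators for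 $Q$, i.e. Pauli operators $\bar X_1,\bar Z_1,\dots,\bar X_k,\bar Z_k$ that commute with every element of $\mathcal S$ and satisfy the relations of the operators $X_1,Z_1,\dots,X_k,Z_k$ on $k$ qubits. Say that a logical gate $U$ acts only on the logical qubit $s$ if $U\bar X_tP_Q=\bar X_tUP_Q$ and $U\bar Z_tP_Q=\bar Z_tUP_Q$ for all $t\ne s$, and that a set $A$ of logical operations is encoded computationally universal for the logical qubit $s$ if for every logical gate $U$ that acts only on the logical qubit $s$ and every $\epsilon>0$ there are $V_1,\dots,V_m\in A$ with $$\|UP_Q-V_1V_2\cdots V_mP_Q\|<\epsilon$$ in the operator norm. Then, for every choice of the logical Pauli operators and for every logical qubit $s\in\{1,\dots,k\}$, $\mathrm{Aut}(Q)$ is not encoded computationally universal for the logical qubit $s$. -/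

import Mathlib

open scoped Matrix Matrix.Norms.L2Operator

noncomputable section

namespace StabCode

/-- The labels of the computational basis `|x₁ … xₙ⟩` of `(ℂ²)^{⊗ n}`. -/
abbrev Bits (n : ℕ) : Type := Fin n → Fin 2

/-- Operators on `(ℂ²)^{⊗ n}`, as matrices in the computational basis. The norm on this type is
the operator norm induced by the Euclidean norm. -/
abbrev Op (n : ℕ) : Type := Matrix (Bits n) (Bits n) ℂ

/-- The unitary gates on `n` qubits. -/
abbrev Gate (n : ℕ) : Type := Matrix.unitaryGroup (Bits n) ℂ

/-- The labels of the four one-qubit Pauli matrices. -/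
inductive Pauli : Type
  | I | X | Y | Z

/-- The `2 × 2` identity matrix and the Pauli matrices. -/
def Pauli.mat : Pauli → Matrix (Fin 2) (Fin 2) ℂ
  | .I => 1
  | .X => !![0, 1; 1, 0]
  | .Y => !![0, -Complex.I; Complex.I, 0]
  | .Z => !![1, 0; 0, -1]

/-- The tensor product `A₁ ⊗ ⋯ ⊗ Aₙ` of one-qubit operators. -/
def tensor {n : ℕ} (A : Fin n → Matrix (Fin 2) (Fin 2) ℂ) : Op n :=
  Matrix.of fun x y => ∏ i, A i (x i) (y i)

/-- `P_π`, the operator with `P_π |ψ₁ … ψₙ⟩ = |ψ_{π(1)} … ψ_{π(n)}⟩` on basis states. -/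
def permOp {n : ℕ} (π : Equiv.Perm (Fin n)) : Op n :=
  Matrix.of fun x y => if x = fun i => y (π i) then 1 else 0

/-- `M = α · p₁ ⊗ ⋯ ⊗ pₙ` with a phase `α ∈ {±1, ±i}`. For a Pauli operator `M` the phase and the
labels `p₁, …, pₙ` are uniquely determined. -/
def HasPauliForm {n : ℕ} (M : Op n) (α : ℂ) (p : Fin n → Pauli) : Prop :=
  (α = 1 ∨ α = -1 ∨ α = Complex.I ∨ α = -Complex.I) ∧ M = α • tensor fun i => (p i).mat

/-- The underlying set of the `n`-qubit Pauli group. -/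
def pauliGroup (n : ℕ) : Set (Gate n) :=
  {R | ∃ α p, HasPauliForm (R : Op n) α p}

/-- The coordinate `j` belongs to the support of the Pauli operator `R`. -/
def InSupport {n : ℕ} (R : Gate n) (j : Fin n) : Prop :=
  ∃ α p, HasPauliForm (R : Op n) α p ∧ p j ≠ Pauli.I

/-- A stabilizer: an abelian subgroup of the `n`-qubit Pauli group which does not contain `-I`. -/
structure Stabilizer (n : ℕ) where
  group : Subgroup (Gate n)
  pauli : ∀ R ∈ group, R ∈ pauliGroup n
  abelian : ∀ R ∈ group, ∀ R' ∈ group, R * R' = R' * R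
  neg_one_notMem : (-1 : Gate n) ∉ group

namespace Stabilizer

variable {n : ℕ} (S : Stabilizer n)

/-- The stabilizer code `Q`: the joint `+1` eigenspace of the stabilizer. -/
def code : Submodule ℂ (EuclideanSpace ℂ (Bits n)) where
  carrier := {ψ | ∀ R ∈ S.group, Matrix.toEuclideanCLM (𝕜 := ℂ) (R : Op n) ψ = ψ}
  add_mem' := fun ha hb R hR => by rw [map_add, ha R hR, hb R hR]
  zero_mem' := fun _ _ => map_zero _
  smul_mem' := fun c _ ha R hR => by rw [map_smul, ha R hR]

/-- `P_Q`, the orthogonal projector onto the code. -/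
def proj : Op n :=
  (Matrix.toEuclideanCLM (n := Bits n) (𝕜 := ℂ)).symm S.code.starProjection

/-- The stabilizer has `2 ^ (n - k)` elements, so that its code has `k` logical qubits. -/
def HasLogicalQubits (k : ℕ) : Prop :=
  Nat.card S.group * 2 ^ k = 2 ^ n

/-- The code is free of trivially encoded qubits: every coordinate is in the support of some
element of the stabilizer. -/
def FreeOfTriviallyEncodedQubits : Prop :=
  ∀ j : Fin n, ∃ R ∈ S.group, InSupport R j

/-- The unitary `U` preserves the code: `[U, P_Q] = 0`. -/
def IsLogical (U : Gate n) : Prop :=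
  (U : Op n) * S.proj = S.proj * (U : Op n)

/-- The set of logical gates on the code: the elements of `SU(2ⁿ)` that commute with `P_Q`. -/
def logicalGates : Set (Gate n) :=
  {U | (U : Op n).det = 1 ∧ S.IsLogical U}

/-- The full automorphism group of the code: all logical operations of the form
`P_π (U₁ ⊗ ⋯ ⊗ Uₙ)` with a coordinate permutation `π` and one-qubit unitaries `Uᵢ`.
Global phases are not normalized. -/
def aut : Set (Gate n) :=
  {V | S.IsLogical V ∧ ∃ (π : Equiv.Perm (Fin n)) (U : Fin n → Matrix.unitaryGroup (Fin 2) ℂ),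
    (V : Op n) = permOp π * tensor fun i => (U i : Matrix (Fin 2) (Fin 2) ℂ)}

/-- A choice of logical Pauli operators for `k` logical qubits: Pauli operators `X̄ᵢ`, `Z̄ᵢ` in the
centralizer of the stabilizer that obey the relations of `Xᵢ`, `Zᵢ` in the `k`-qubit Pauli
group. -/
structure LogicalPaulis (k : ℕ) where
  X : Fin k → Gate n
  Z : Fin k → Gate n
  X_pauli : ∀ i, X i ∈ pauliGroup n
  Z_pauli : ∀ i, Z i ∈ pauliGroup n
  X_centralizes : ∀ i, ∀ R ∈ S.group, X i * R = R * X i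
  Z_centralizes : ∀ i, ∀ R ∈ S.group, Z i * R = R * Z i
  X_sq : ∀ i, X i * X i = 1
  Z_sq : ∀ i, Z i * Z i = 1
  X_comm : ∀ i j, X i * X j = X j * X i
  Z_comm : ∀ i j, Z i * Z j = Z j * Z i
  XZ_comm : ∀ i j, i ≠ j → X i * Z j = Z j * X i
  XZ_anticomm : ∀ i, X i * Z i = -(Z i * X i)

variable {S}

/-- On the code, the gate `U` acts on the logical qubit `s` only: it commutes there with the logical
Pauli operators of all other logical qubits. For a logical gate this says that its action on the
code is `I ⊗ ⋯ ⊗ u ⊗ ⋯ ⊗ I` with a one-qubit gate `u` on the logical qubit `s`. -/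
def LogicalPaulis.ActsOnlyOn {k : ℕ} (L : S.LogicalPaulis k) (s : Fin k) (U : Gate n) : Prop :=
  ∀ t, t ≠ s →
    (U : Op n) * (L.X t : Op n) * S.proj = (L.X t : Op n) * (U : Op n) * S.proj ∧
    (U : Op n) * (L.Z t : Op n) * S.proj = (L.Z t : Op n) * (U : Op n) * S.proj

/-- The set `A` of gates is encoded computationally universal for the logical qubit `s`: on the code,
every logical gate acting on that logical qubit only is approximated to arbitrary accuracy, in
operator norm, by products of gates in `A`. -/
def LogicalPaulis.EncodedUniversalFor {k : ℕ} (L : S.LogicalPaulis k) (s : Fin k)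
    (A : Set (Gate n)) : Prop :=
  ∀ U ∈ S.logicalGates, L.ActsOnlyOn s U →
    ∀ ε : ℝ, 0 < ε → ∃ Vs : List (Gate n), (∀ V ∈ Vs, V ∈ A) ∧
      ‖(U : Op n) * S.proj - (Vs.prod : Op n) * S.proj‖ < ε

end Stabilizer

end StabCode

end

/-! Universality would force some fixed power of all logical gates on qubit `s` to commute with one
another on the code, and rotations about the logical `X` and `Z` do not. There is one exponent `M`
such that `V ^ M`, for every automorphism `V`, agrees on the code with an element of a commutative
algebra `siteAlg` (`exists_pow_mul_proj_mem`). Raising `V` to the order of the symmetric group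
removes the permutation, and a further power, bounded by compactness of `U(2)^n`, brings every
tensor factor close to `1`. Such a product is `exp (iA)` with `A` a small sum of one-site Hermitian
operators. As a function of the product, `A` commutes with `P_Q`; averaging each summand over the
stabilizer then replaces `A` on the code by a sum of one-site operators that commute with the
stabilizer (`exists_twirl`, `exists_mem_siteAlg_of_norm_lt`). These generate a commutative algebra,
because on each coordinate they commute with a non-identity Pauli matrix. Commutation survives
limits, yet the `M`-th powers of the rotations by `π / (2M)` are `iX̄` and `iZ̄`, which anticommute
on the nonzero code. -/

noncomputable section

namespace StabCode

/-! ### Tensor products and one-site operators. -/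

theorem tensor_mul {n : ℕ} (A B : Fin n → Matrix (Fin 2) (Fin 2) ℂ) :
    tensor A * tensor B = tensor fun i => A i * B i := by
  ext x y
  simp only [tensor, Matrix.mul_apply, Matrix.of_apply, Finset.prod_univ_sum,
    Fintype.piFinset_univ, Finset.prod_mul_distrib]

theorem tensor_one {n : ℕ} : tensor (fun _ : Fin n => (1 : Matrix (Fin 2) (Fin 2) ℂ)) = 1 := by
  ext x y
  simp only [tensor, Matrix.of_apply, Matrix.one_apply, Finset.prod_ite_zero, funext_iff]
  simp

theorem tensor_conjTranspose {n : ℕ} (A : Fin n → Matrix (Fin 2) (Fin 2) ℂ) :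
    (tensor A)ᴴ = tensor fun i => (A i)ᴴ := by
  ext x y
  simp [tensor, Matrix.conjTranspose_apply]

theorem tensor_pow {n : ℕ} (A : Fin n → Matrix (Fin 2) (Fin 2) ℂ) (m : ℕ) :
    tensor A ^ m = tensor fun i => A i ^ m := by
  induction m with
  | zero => simp [tensor_one]
  | succ m ih => simp [pow_succ, ih, tensor_mul]

theorem trace_tensor {n : ℕ} (A : Fin n → Matrix (Fin 2) (Fin 2) ℂ) :
    (tensor A).trace = ∏ i, (A i).trace := by
  simp only [Matrix.trace, Finset.prod_univ_sum, Fintype.piFinset_univ, tensor, Matrix.diag,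
    Matrix.of_apply]

/-- The one-qubit operator `M` acting on the coordinate `j`. -/
def site {n : ℕ} (j : Fin n) : Matrix (Fin 2) (Fin 2) ℂ →⋆ₐ[ℂ] Op n where
  toFun M := tensor (Function.update 1 j M)
  map_one' := by
    rw [← tensor_one]; congr 1; ext1 i; simp
  map_mul' M N := by
    rw [tensor_mul]; congr 1; ext1 i
    by_cases h : i = j
    · subst h; simp
    · simp [h]
  map_zero' := by
    ext x y
    simp only [tensor, Matrix.of_apply, Matrix.zero_apply]
    exact Finset.prod_eq_zero (Finset.mem_univ j) (by simp)
  map_add' M N := by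
    ext x y
    simp only [tensor, Matrix.of_apply, Matrix.add_apply]
    rw [← Finset.mul_prod_erase _ _ (Finset.mem_univ j),
      ← Finset.mul_prod_erase _ _ (Finset.mem_univ j),
      ← Finset.mul_prod_erase _ _ (Finset.mem_univ j)]
    have h : ∀ K : Matrix (Fin 2) (Fin 2) ℂ,
        ∏ i ∈ Finset.univ.erase j, (Function.update (1 : Fin n → Matrix (Fin 2) (Fin 2) ℂ) j K) i
          (x i) (y i) = ∏ i ∈ Finset.univ.erase j, (1 : Matrix (Fin 2) (Fin 2) ℂ) (x i) (y i) := by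
      intro K
      refine Finset.prod_congr rfl fun i hi => ?_
      rw [Function.update_of_ne (Finset.ne_of_mem_erase hi)]; rfl
    simp only [h, Function.update_self, Matrix.add_apply, add_mul]
  commutes' c := by
    ext x y
    simp only [tensor, Matrix.of_apply]
    rw [← Finset.mul_prod_erase _ _ (Finset.mem_univ j)]
    have h : ∏ i ∈ Finset.univ.erase j,
          (Function.update (1 : Fin n → Matrix (Fin 2) (Fin 2) ℂ) j (algebraMap ℂ _ c)) i
          (x i) (y i) = ∏ i ∈ Finset.univ.erase j, (1 : Matrix (Fin 2) (Fin 2) ℂ) (x i) (y i) := by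
      refine Finset.prod_congr rfl fun i hi => ?_
      rw [Function.update_of_ne (Finset.ne_of_mem_erase hi)]; rfl
    have h1 : (1 : Op n) x y = ∏ i, (1 : Matrix (Fin 2) (Fin 2) ℂ) (x i) (y i) := by
      rw [← tensor_one]; rfl
    rw [h, Function.update_self, Algebra.algebraMap_eq_smul_one, Algebra.algebraMap_eq_smul_one,
      Matrix.smul_apply, Matrix.smul_apply, h1, ← Finset.mul_prod_erase _ _ (Finset.mem_univ j),
      smul_mul_assoc]
  map_star' M := by
    rw [Matrix.star_eq_conjTranspose, Matrix.star_eq_conjTranspose, tensor_conjTranspose]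
    congr 1; ext1 i
    by_cases h : i = j
    · subst h; simp
    · simp [h]

theorem site_apply {n : ℕ} (j : Fin n) (M : Matrix (Fin 2) (Fin 2) ℂ) :
    site j M = tensor (Function.update 1 j M) := rfl

theorem site_commute {n : ℕ} {i j : Fin n} (h : i ≠ j) (M N : Matrix (Fin 2) (Fin 2) ℂ) :
    Commute (site i M) (site j N) := by
  rw [Commute, SemiconjBy, site_apply, site_apply, tensor_mul, tensor_mul]
  congr 1; ext1 l
  by_cases h1 : l = i
  · subst h1; simp [h]
  · simp [h1]

/-- The matrix ring is simple, so every ring homomorphism from it to a nontrivial ring is injective.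
-/
theorem site_injective {n : ℕ} (j : Fin n) : Function.Injective (site j) :=
  (site j : Matrix (Fin 2) (Fin 2) ℂ →+* Op n).injective

theorem tensor_exp {n : ℕ} (A : Fin n → Matrix (Fin 2) (Fin 2) ℂ) :
    tensor (fun j => NormedSpace.exp (A j)) = NormedSpace.exp (∑ j, site j (A j)) := by
  classical
  have key : ∀ s : Finset (Fin n), tensor (fun j => if j ∈ s then NormedSpace.exp (A j) else 1) =
      NormedSpace.exp (∑ j ∈ s, site j (A j)) := by
    intro s
    induction s using Finset.induction_on with
    | empty => simp [tensor_one]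
    | insert a s ha ih =>
      let +nondep : NormedAlgebra ℚ (Matrix (Fin 2) (Fin 2) ℂ) := NormedAlgebra.restrictScalars ℚ ℂ _
      have hc : Continuous (site a : Matrix (Fin 2) (Fin 2) ℂ → Op n) :=
        (site a : Matrix (Fin 2) (Fin 2) ℂ →⋆ₐ[ℂ]
          Op n).toAlgHom.toLinearMap.continuous_of_finiteDimensional
      rw [Finset.sum_insert ha, Matrix.exp_add_of_commute, ← ih, ← NormedSpace.map_exp (site a) hc,
        site_apply, tensor_mul]
      · congr 1; ext1 i
        by_cases h : i = a
        · subst h; simp [ha]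
        · simp [h]
      · exact Commute.sum_right _ _ _ fun i hi => site_commute (by rintro rfl; exact ha hi) _ _
  simpa using key Finset.univ

/-! ### Pauli matrices and their centralizers. -/

theorem Pauli.mat_mul_self (p : Pauli) : p.mat * p.mat = 1 := by
  cases p <;> simp [Pauli.mat, Matrix.one_fin_two]

theorem Pauli.trace_mat {p : Pauli} (h : p ≠ .I) : p.mat.trace = 0 := by
  cases p <;> simp_all [Pauli.mat, Matrix.trace_fin_two]

/-- The centralizer of a non-identity Pauli matrix `p` is the span of `1` and `p`. -/
theorem Pauli.commute_of_commute_mat {p : Pauli} (h : p ≠ .I) {M N : Matrix (Fin 2) (Fin 2) ℂ}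
    (hM : Commute M p.mat) (hN : Commute N p.mat) : Commute M N := by
  have e : ∀ {K : Matrix (Fin 2) (Fin 2) ℂ}, Commute K p.mat → ∃ c d : ℂ, K = c • 1 + d • p.mat := by
    intro K hK
    have h0 := congrFun₂ hK.eq
    have h00 := h0 0 0
    have h01 := h0 0 1
    have h10 := h0 1 0
    cases p with
    | I => exact absurd rfl h
    | X =>
      simp [Pauli.mat, Matrix.mul_apply] at h00 h01 h10
      refine ⟨K 0 0, K 0 1, ?_⟩
      ext i j; fin_cases i <;> fin_cases j <;> simp [Pauli.mat, h00, h01]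
    | Y =>
      simp [Pauli.mat, Matrix.mul_apply] at h00 h01 h10
      have hI := Complex.I_ne_zero
      have h1 : K 0 1 = - K 1 0 := mul_right_cancel₀ hI (by linear_combination h00)
      have h2 : K 1 1 = K 0 0 := mul_right_cancel₀ hI (by linear_combination h10)
      refine ⟨K 0 0, Complex.I * K 0 1, ?_⟩
      ext i j; fin_cases i <;> fin_cases j <;> simp [Pauli.mat, h1, h2]
      linear_combination (norm := ring_nf) (-K 1 0) * Complex.I_mul_I
      linear_combination (K 1 0) * Complex.I_mul_I
    | Z =>
      simp [Pauli.mat, Matrix.mul_apply] at h00 h01 h10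
      have h1 : K 0 1 = 0 := by linear_combination (-1/2) * h01
      have h2 : K 1 0 = 0 := by linear_combination (1/2) * h10
      refine ⟨(K 0 0 + K 1 1) / 2, (K 0 0 - K 1 1) / 2, ?_⟩
      ext i j; fin_cases i <;> fin_cases j <;> simp [Pauli.mat, h1, h2] <;> ring
  obtain ⟨a, b, rfl⟩ := e hM
  obtain ⟨c, d, rfl⟩ := e hN
  have h1 : ∀ K : Matrix (Fin 2) (Fin 2) ℂ, Commute 1 K := Commute.one_left
  exact (((h1 _).smul_left _).add_left ((((h1 _).symm.smul_right _).add_right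
    ((Commute.refl _).smul_right _)).smul_left _))

/-- Conjugation by a Pauli operator keeps a one-site operator on its site; this is what makes
averaging over the stabilizer local. -/
theorem HasPauliForm.mul_site {n : ℕ} {R : Op n} {α : ℂ} {p : Fin n → Pauli}
    (h : HasPauliForm R α p) (j : Fin n) (M : Matrix (Fin 2) (Fin 2) ℂ) :
    R * site j M = site j ((p j).mat * M * (p j).mat) * R := by
  rw [h.2, smul_mul_assoc, mul_smul_comm, site_apply, site_apply, tensor_mul, tensor_mul]
  congr 2; ext1 i
  by_cases h : i = j
  · subst h; simp [mul_assoc, Pauli.mat_mul_self]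
  · simp [h]

/-! ### The code projector. -/

namespace Stabilizer

variable {n : ℕ} (S : Stabilizer n)

theorem toEuclideanCLM_injective {A B : Op n}
    (h : Matrix.toEuclideanCLM (n := Bits n) (𝕜 := ℂ) A = Matrix.toEuclideanCLM (𝕜 := ℂ) B) : A = B :=
  (Matrix.toEuclideanCLM (n := Bits n) (𝕜 := ℂ)).injective h

theorem toEuclideanCLM_proj :
    Matrix.toEuclideanCLM (n := Bits n) (𝕜 := ℂ) S.proj = S.code.starProjection :=
  StarAlgEquiv.apply_symm_apply _ _

theorem star_proj : star S.proj = S.proj := by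
  apply toEuclideanCLM_injective
  rw [map_star, toEuclideanCLM_proj]
  exact isStarProjection_starProjection.isSelfAdjoint

theorem proj_mul_self : S.proj * S.proj = S.proj := by
  apply toEuclideanCLM_injective
  rw [map_mul, toEuclideanCLM_proj]
  exact isStarProjection_starProjection.isIdempotentElem

theorem mul_proj {R : Gate n} (hR : R ∈ S.group) : (R : Op n) * S.proj = S.proj := by
  apply toEuclideanCLM_injective
  rw [map_mul, toEuclideanCLM_proj]
  ext1 ψ
  exact (S.code.starProjection_apply_mem ψ : _ ∈ S.code) R hR

theorem proj_mul_eq {T : Op n} (hT : ∀ R ∈ S.group, (R : Op n) * T = T) : S.proj * T = T := by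
  apply toEuclideanCLM_injective
  rw [map_mul, toEuclideanCLM_proj]
  ext1 ψ
  refine Submodule.starProjection_eq_self_iff.2 fun R hR => ?_
  have := congrArg (fun A : Op n => Matrix.toEuclideanCLM (n := Bits n) (𝕜 := ℂ) A ψ) (hT R hR)
  rw [map_mul] at this
  exact this

theorem proj_mul {R : Gate n} (hR : R ∈ S.group) : S.proj * (R : Op n) = S.proj := by
  have h := congrArg star (S.mul_proj (inv_mem hR))
  rw [star_mul, star_proj] at h
  simpa using h

theorem mul_proj_eq {T : Op n} (hT : ∀ R ∈ S.group, T * (R : Op n) = T) : T * S.proj = T := by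
  have h : S.proj * star T = star T := S.proj_mul_eq fun R hR => by
    have h := congrArg star (hT _ (inv_mem hR))
    rw [star_mul] at h
    simpa using h
  have := congrArg star h
  rwa [star_mul, star_star, star_proj] at this

theorem commute_proj {a : Op n} (ha : ∀ R ∈ S.group, Commute (R : Op n) a) :
    Commute a S.proj := by
  have h1 : S.proj * (a * S.proj) = a * S.proj := S.proj_mul_eq fun R hR => by
    rw [← mul_assoc, (ha R hR).eq, mul_assoc, S.mul_proj hR]
  have h2 : (S.proj * a) * S.proj = S.proj * a := S.mul_proj_eq fun R hR => by
    rw [mul_assoc, ← (ha R hR).eq, ← mul_assoc, S.proj_mul hR]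
  rw [Commute, SemiconjBy, ← h1, ← mul_assoc, h2]

variable {S}

theorem HasLogicalQubits.finite {k : ℕ} (hk : S.HasLogicalQubits k) : Finite S.group := by
  refine Nat.finite_of_card_ne_zero fun h => ?_
  rw [HasLogicalQubits, h, zero_mul] at hk
  exact pow_ne_zero n two_ne_zero hk.symm

/-- A non-identity tensor factor kills the trace. The remaining scalars are excluded by `-1 ∉ S`,
since `±i` square to `-1`. -/
theorem trace_eq_zero {R : Gate n} (hR : R ∈ S.group) (h1 : R ≠ 1) : (R : Op n).trace = 0 := by
  obtain ⟨α, p, hα, h⟩ := S.pauli R hR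
  by_cases hp : ∃ j, p j ≠ .I
  · obtain ⟨j, hj⟩ := hp
    rw [h, Matrix.trace_smul, trace_tensor,
      Finset.prod_eq_zero (Finset.mem_univ j) (Pauli.trace_mat hj), smul_zero]
  · push Not at hp
    have h : (R : Op n) = α • 1 := by
      rw [h, ← tensor_one]; simp [hp, Pauli.mat]
    have hsq : α * α = -1 → False := fun hα => S.neg_one_notMem <| by
      have : R * R = -1 := Subtype.ext <| by
        rw [Submonoid.coe_mul, h, smul_mul_smul_comm, hα, one_mul, neg_one_smul]; rfl
      rw [← this]; exact mul_mem hR hR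
    rcases hα with rfl | rfl | rfl | rfl
    · exact absurd (Subtype.ext (by simpa using h)) h1
    · have : R = -1 := Subtype.ext (by rw [h, neg_one_smul]; rfl)
      exact absurd (this ▸ hR) S.neg_one_notMem
    · exact (hsq (by simp)).elim
    · exact (hsq (by simp)).elim

/-- The sum of all stabilizer elements has its range in the code, and its trace is `2 ^ n`,
contributed by the identity alone. -/
theorem proj_ne_zero [Finite S.group] : S.proj ≠ 0 := by
  intro h0
  cases nonempty_fintype S.group
  have h : S.proj * ∑ R : S.group, ((R : Gate n) : Op n) = ∑ R : S.group, ((R : Gate n) : Op n) :=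
    S.proj_mul_eq fun R hR => by
      rw [Finset.mul_sum]
      exact Fintype.sum_equiv (Equiv.mulLeft (⟨R, hR⟩ : S.group)) _ _ fun _ => rfl
  rw [h0, zero_mul] at h
  have h := congrArg Matrix.trace h
  rw [Matrix.trace_sum, Finset.sum_eq_single 1 (fun R _ hR =>
    trace_eq_zero R.2 fun h => hR (Subtype.ext h)) (by simp)] at h
  simp at h
  exact pow_ne_zero n two_ne_zero h.symm

/-! ### The commutative algebra of local symmetries, and small local unitaries. -/

/-- The algebra of the operators that commute with everything which commutes with the
one-qubit operators commuting with the stabilizer. -/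
def siteAlg (S : Stabilizer n) : Subalgebra ℂ (Op n) :=
  Subalgebra.centralizer ℂ (Set.centralizer
    {a | (∃ j M, a = site j M) ∧ ∀ R ∈ S.group, Commute (R : Op n) a})

theorem mem_siteAlg {j : Fin n} {M : Matrix (Fin 2) (Fin 2) ℂ}
    (h : ∀ R ∈ S.group, Commute (R : Op n) (site j M)) : site j M ∈ S.siteAlg := by
  rw [siteAlg, ← SetLike.mem_coe, Subalgebra.coe_centralizer]
  exact Set.subset_centralizer_centralizer ⟨⟨j, M, rfl⟩, h⟩

/-- The projector commutes with the generators, so it is one of the operators that the double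
centralizer commutes with. -/
theorem commute_proj_of_mem_siteAlg {a : Op n} (h : a ∈ S.siteAlg) : Commute S.proj a :=
  (Subalgebra.mem_centralizer_iff ℂ).1 h _ <| Set.mem_centralizer_iff.2 fun _ hb =>
    (S.commute_proj hb.2).eq

theorem exp_mem_siteAlg {a : Op n} (h : a ∈ S.siteAlg) : NormedSpace.exp a ∈ S.siteAlg :=
  (Subalgebra.mem_centralizer_iff ℂ).2 fun g hg =>
    Commute.exp_right ((Subalgebra.mem_centralizer_iff ℂ).1 h g hg)

/-- The double centralizer of a commuting set is commutative, so it suffices to compare generators.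
On a common site `j`, both commute with the Pauli label at `j` of a stabilizer element supported
there. -/
theorem FreeOfTriviallyEncodedQubits.commute (hS : S.FreeOfTriviallyEncodedQubits) {a b : Op n}
    (ha : a ∈ S.siteAlg) (hb : b ∈ S.siteAlg) : Commute a b := by
  refine (Subalgebra.mem_centralizer_iff ℂ).1 hb a ?_
  refine Set.centralizer_subset ?_ ha
  rintro _ ⟨⟨i, M, rfl⟩, hM⟩
  refine Set.mem_centralizer_iff.2 ?_
  rintro _ ⟨⟨j, N, rfl⟩, hN⟩
  by_cases hij : j = i
  swap
  · exact site_commute hij _ _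
  subst hij
  obtain ⟨R, hR, α, p, h, hp⟩ := hS j
  have key : ∀ K, Commute (R : Op n) (site j K) → Commute K (p j).mat := fun K hK => by
    have h1 := (h.mul_site j K).symm.trans hK.eq
    have hR' : (R : Op n) * star (R : Op n) = 1 := Unitary.mul_star_self_of_mem R.2
    have h1 := congrArg (· * star (R : Op n)) h1
    simp only [mul_assoc, hR', mul_one] at h1
    have h2 := site_injective j h1
    rw [Commute, SemiconjBy]
    nth_rw 1 [← h2]
    rw [mul_assoc, mul_assoc, Pauli.mat_mul_self, mul_one]
  exact ((Pauli.commute_of_commute_mat hp (key _ (hN R hR)) (key _ (hM R hR))).map (site j)).eq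

/-- The witness is the average of `R * site j M * R⁻¹` over the stabilizer. It commutes with the
stabilizer, and the projectors on both sides absorb `R` and `R⁻¹`. -/
theorem exists_twirl [Finite S.group] (j : Fin n) (M : Matrix (Fin 2) (Fin 2) ℂ) :
    ∃ a ∈ S.siteAlg, S.proj * site j M * S.proj = a * S.proj := by
  cases nonempty_fintype S.group
  have hform : ∀ R : S.group, ∃ N, ((R : Gate n) : Op n) * site j M =
      site j N * ((R : Gate n) : Op n) := fun R => by
    obtain ⟨α, p, h⟩ := S.pauli R R.2
    exact ⟨_, h.mul_site j M⟩
  choose N hN using hform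
  have hN' : ∀ R : S.group, ((R : Gate n) : Op n) * site j M * ((R⁻¹ : S.group) : Gate n) =
      site j (N R) := fun R => by
    rw [hN, mul_assoc, ← Submonoid.coe_mul, ← Subgroup.coe_mul, mul_inv_cancel]; simp
  set c : ℂ := (Fintype.card S.group : ℂ)⁻¹
  have hc : c * Fintype.card S.group = 1 := inv_mul_cancel₀ (by simp)
  have hmem : site j (c • ∑ R, N R) ∈ S.siteAlg := mem_siteAlg fun R hR => by
    rw [map_smul, map_sum]
    refine Commute.smul_right ?_ _
    rw [Commute, SemiconjBy, Finset.mul_sum, Finset.sum_mul]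
    refine Fintype.sum_equiv (Equiv.mulLeft (⟨R, hR⟩ : S.group)) _ _ fun R' => ?_
    rw [← hN', ← hN']
    have hR' : star (R : Op n) * (R : Op n) = 1 := Unitary.star_mul_self_of_mem R.2
    simp [mul_assoc, hR']
  have h1 : S.proj * site j (c • ∑ R, N R) * S.proj = S.proj * site j M * S.proj := by
    have : ∀ R : S.group, S.proj * site j (N R) * S.proj = S.proj * site j M * S.proj := fun R => by
      rw [← hN', ← mul_assoc, ← mul_assoc, S.proj_mul R.2, mul_assoc, S.mul_proj (R⁻¹).2]
    rw [map_smul, map_sum, mul_smul_comm, smul_mul_assoc, Finset.mul_sum, Finset.sum_mul,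
      Finset.sum_congr rfl fun R _ => this R, Finset.sum_const, Finset.card_univ,
      ← Nat.cast_smul_eq_nsmul ℂ, smul_smul, hc, one_smul]
  refine ⟨_, hmem, ?_⟩
  rw [← h1, (commute_proj_of_mem_siteAlg hmem).eq, mul_assoc, S.proj_mul_self]

/-- The bound `2` makes `Unitary.argSelfAdjoint` a logarithm of each factor; the bound `π / (n + 1)`
keeps the sum of the `n` logarithms below `π`, where it is recovered from its exponential. -/
theorem exists_mem_siteAlg_of_norm_lt [Finite S.group]
    {U : Fin n → Matrix.unitaryGroup (Fin 2) ℂ}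
    (hU : ∀ j, ‖(U j - 1 : Matrix (Fin 2) (Fin 2) ℂ)‖ < 2)
    (hU' : ∀ j, ‖Unitary.argSelfAdjoint (U j)‖ < Real.pi / (n + 1))
    (hP : Commute (tensor fun j => (U j : Matrix (Fin 2) (Fin 2) ℂ)) S.proj) :
    ∃ a ∈ S.siteAlg, (tensor fun j => (U j : Matrix (Fin 2) (Fin 2) ℂ)) * S.proj = a * S.proj := by
  set W := tensor fun j => (U j : Matrix (Fin 2) (Fin 2) ℂ) with hW
  let A : Op n := ∑ j, site j (Unitary.argSelfAdjoint (U j) : Matrix (Fin 2) (Fin 2) ℂ)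
  have hA : IsSelfAdjoint A := sum_mem (S := selfAdjoint (Op n)) fun j _ =>
    IsSelfAdjoint.map (Unitary.argSelfAdjoint (U j)).2 (site j)
  have hAnorm : ‖A‖ < Real.pi := by
    have hn : (0 : ℝ) < n + 1 := by positivity
    calc ‖A‖ ≤ ∑ j : Fin n, ‖site j (Unitary.argSelfAdjoint (U j) : Matrix (Fin 2) (Fin 2) ℂ)‖ :=
          norm_sum_le _ _
      _ ≤ ∑ _j : Fin n, Real.pi / (n + 1) := Finset.sum_le_sum fun j _ =>
          (NonUnitalStarAlgHom.norm_apply_le (site j) _).trans (hU' j).le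
      _ = n * (Real.pi / (n + 1)) := by simp
      _ < Real.pi := by
        rw [mul_div_assoc', div_lt_iff₀ hn]
        nlinarith [Real.pi_pos]
  have hexp : W = NormedSpace.exp (Complex.I • A) := by
    rw [Finset.smul_sum]
    simp only [← map_smul]
    rw [← tensor_exp, hW]
    congr 1; ext1 j
    conv_lhs => rw [← expUnitary_argSelfAdjoint (hU j)]
    rfl
  have hAP : Commute A S.proj := by
    have h1 := congrArg Subtype.val (argSelfAdjoint_expUnitary (x := ⟨A, hA⟩) hAnorm)
    rw [Unitary.argSelfAdjoint_coe, selfAdjoint.expUnitary_coe, ← hexp] at h1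
    change _ = A at h1
    rw [← h1]
    -- `A` is the continuous functional calculus of `W`, so it commutes with whatever commutes with
    -- `W` and `star W`.
    refine Commute.cfc hP ?_ _
    have := hP.star_star
    rwa [S.star_proj] at this
  choose b hb hb' using fun j =>
    exists_twirl (S := S) j (Unitary.argSelfAdjoint (U j) : Matrix (Fin 2) (Fin 2) ℂ)
  have hB : ∑ j, b j ∈ S.siteAlg := sum_mem fun j _ => hb j
  have hAB : A * S.proj = (∑ j, b j) * S.proj := by
    rw [← S.proj_mul_self, ← mul_assoc, hAP.eq, Finset.mul_sum, Finset.sum_mul, Finset.sum_mul]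
    simp only [hb', S.proj_mul_self]
  have hIB := Subalgebra.smul_mem _ hB Complex.I
  refine ⟨_, exp_mem_siteAlg hIB, ?_⟩
  -- Intertwining by the projector passes from the exponents to their exponentials.
  have h2 : SemiconjBy S.proj (Complex.I • ∑ j, b j) (Complex.I • A) := by
    rw [SemiconjBy, (commute_proj_of_mem_siteAlg hIB).eq, smul_mul_assoc, smul_mul_assoc, hAB]
  let +nondep : NormedAlgebra ℚ (Op n) := NormedAlgebra.restrictScalars ℚ ℂ _
  rw [hexp, ← h2.exp_right.eq, (commute_proj_of_mem_siteAlg (exp_mem_siteAlg hIB)).eq]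

end Stabilizer

/-! ### Uniform recurrence and removal of the permutation. -/

instance : CompactSpace (Matrix.unitaryGroup (Fin 2) ℂ) := by
  refine isCompact_iff_compactSpace.1 ?_
  have : ProperSpace (Matrix (Fin 2) (Fin 2) ℂ) := FiniteDimensional.proper ℂ _
  refine Metric.isCompact_of_isClosed_isBounded isClosed_unitary ?_
  refine (Metric.isBounded_closedBall (x := 0) (r := 1)).subset fun u hu => ?_
  rw [mem_closedBall_zero_iff]
  exact CStarRing.norm_of_mem_unitary hu |>.le

/-- In a compact group `1` is a cluster point of the powers of each `g`. The open sets of those `g`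
whose `q`-th power lies in the interior of `O` cover the group, and a finite subcover bounds `q`. -/
theorem exists_uniform_pow_mem {G : Type*} [Group G] [TopologicalSpace G] [CompactSpace G]
    [IsTopologicalGroup G] {O : Set G} (hO : O ∈ nhds 1) :
    ∃ m : ℕ, ∀ g : G, ∃ q, 0 < q ∧ q ≤ m ∧ g ^ q ∈ O := by
  have h1 : ∀ g : G, ∃ q, 0 < q ∧ g ^ q ∈ interior O := fun g => by
    have h := (mapClusterPt_one_atTop_pow g).frequently (interior_mem_nhds.2 hO)
    obtain ⟨q, hq, hq'⟩ := (h.and_eventually (Filter.eventually_gt_atTop 0)).exists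
    exact ⟨q, hq', hq⟩
  obtain ⟨t, ht⟩ := isCompact_univ.elim_finite_subcover
    (fun q : {q : ℕ // 0 < q} => {g : G | g ^ (q : ℕ) ∈ interior O})
    (fun q => isOpen_interior.preimage (continuous_pow _))
    (fun g _ => by
      obtain ⟨q, hq, hq'⟩ := h1 g
      exact Set.mem_iUnion.2 ⟨⟨q, hq⟩, hq'⟩)
  refine ⟨t.sup (fun q => (q : ℕ)), fun g => ?_⟩
  obtain ⟨q, hq, hg⟩ := Set.mem_iUnion₂.1 (ht (Set.mem_univ g))
  exact ⟨q, q.2, Finset.le_sup (f := fun q : {q : ℕ // 0 < q} => (q : ℕ)) hq, interior_subset hg⟩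

theorem permOp_mul_permOp {n : ℕ} (π ρ : Equiv.Perm (Fin n)) :
    permOp π * permOp ρ = permOp (ρ * π) := by
  ext x y
  simp only [permOp, Matrix.mul_apply, Matrix.of_apply, mul_ite, mul_one, mul_zero]
  rw [Finset.sum_ite_eq_of_mem' _ (fun i => y (ρ i)) _ (Finset.mem_univ _)]
  rfl

theorem tensor_mul_permOp {n : ℕ} (A : Fin n → Matrix (Fin 2) (Fin 2) ℂ) (π : Equiv.Perm (Fin n)) :
    tensor A * permOp π = permOp π * tensor fun i => A (π.symm i) := by
  ext x y
  simp only [permOp, Matrix.mul_apply, Matrix.of_apply, mul_ite, mul_one, mul_zero, ite_mul,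
    one_mul, zero_mul]
  rw [Finset.sum_ite_eq_of_mem' _ (fun i => y (π i)) _ (Finset.mem_univ _)]
  have h : ∀ z : Bits n, (x = fun i => z (π i)) ↔ z = fun i => x (π.symm i) := fun z => by
    constructor
    · rintro rfl; simp
    · rintro rfl; simp
  simp only [h]
  rw [Finset.sum_ite_eq_of_mem' _ (fun i => x (π.symm i)) _ (Finset.mem_univ _)]
  simp only [tensor, Matrix.of_apply]
  exact Fintype.prod_equiv π _ _ fun i => by simp

theorem permOp_one {n : ℕ} : permOp (1 : Equiv.Perm (Fin n)) = 1 := by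
  ext x y
  exact if_congr Iff.rfl rfl rfl

theorem pow_eq_permOp_mul_tensor {n : ℕ} {V : Op n} {π : Equiv.Perm (Fin n)}
    {U : Fin n → Matrix.unitaryGroup (Fin 2) ℂ}
    (h : V = permOp π * tensor fun i => (U i : Matrix (Fin 2) (Fin 2) ℂ)) (m : ℕ) :
    ∃ W : Fin n → Matrix.unitaryGroup (Fin 2) ℂ,
      V ^ m = permOp (π ^ m) * tensor fun i => (W i : Matrix (Fin 2) (Fin 2) ℂ) := by
  induction m with
  | zero => exact ⟨1, by simp [permOp_one, tensor_one]⟩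
  | succ m ih =>
    obtain ⟨W, hW⟩ := ih
    refine ⟨fun i => W (π.symm i) * U i, ?_⟩
    rw [pow_succ, hW, h, mul_assoc, ← mul_assoc (tensor _), tensor_mul_permOp, mul_assoc,
      tensor_mul, ← mul_assoc, permOp_mul_permOp, pow_succ']
    rfl

/-! ### Powers of automorphisms and their limits. -/

namespace Stabilizer

variable {n : ℕ} {S : Stabilizer n}

theorem one_mem_aut : (1 : Gate n) ∈ S.aut :=
  ⟨(Commute.one_left S.proj).eq, 1, 1, by simp [permOp_one, tensor_one]⟩

theorem mul_mem_aut {V W : Gate n} (hV : V ∈ S.aut) (hW : W ∈ S.aut) : V * W ∈ S.aut := by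
  obtain ⟨hV, π, A, hA⟩ := hV
  obtain ⟨hW, ρ, B, hB⟩ := hW
  refine ⟨(Commute.mul_left (show Commute (V : Op n) S.proj from hV) hW).eq, ρ * π,
    fun i => A (ρ.symm i) * B i, ?_⟩
  rw [Submonoid.coe_mul, hA, hB, mul_assoc, ← mul_assoc (tensor _), tensor_mul_permOp, mul_assoc,
    tensor_mul, ← mul_assoc, permOp_mul_permOp]
  rfl

theorem list_prod_mem_aut {Vs : List (Gate n)} (h : ∀ V ∈ Vs, V ∈ S.aut) : Vs.prod ∈ S.aut := by
  induction Vs with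
  | nil => exact one_mem_aut
  | cons V Vs ih =>
    rw [List.prod_cons]
    exact mul_mem_aut (h V (by simp)) (ih fun W hW => h W (by simp [hW]))

theorem pow_mul_proj {T a : Op n} (ha : a ∈ S.siteAlg) (h : T * S.proj = a * S.proj) (m : ℕ) :
    T ^ m * S.proj = a ^ m * S.proj := by
  induction m with
  | zero => simp
  | succ m ih =>
    rw [pow_succ, mul_assoc, h, ← (commute_proj_of_mem_siteAlg ha).eq, ← mul_assoc, ih, mul_assoc,
      (commute_proj_of_mem_siteAlg ha).eq, pow_succ, mul_assoc]

theorem exists_pow_mul_proj_mem [Finite S.group] : ∃ M : ℕ, 0 < M ∧ ∀ V ∈ S.aut,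
    ∃ a ∈ S.siteAlg, (V : Op n) ^ M * S.proj = a * S.proj := by
  let O : Set (Matrix.unitaryGroup (Fin 2) ℂ) :=
    {u | ‖(u - 1 : Matrix (Fin 2) (Fin 2) ℂ)‖ < 2 ∧ ‖Unitary.argSelfAdjoint u‖ < Real.pi / (n + 1)}
  have hO : O ∈ nhds 1 := by
    refine Filter.inter_mem ?_ ?_
    · have hc : Continuous fun u : Matrix.unitaryGroup (Fin 2) ℂ =>
          ‖(u - 1 : Matrix (Fin 2) (Fin 2) ℂ)‖ := by fun_prop
      exact hc.continuousAt.eventually_lt_const (by simp)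
    · have hc := (Unitary.continuousOn_argSelfAdjoint (A := Matrix (Fin 2) (Fin 2) ℂ)).continuousAt
        (Metric.ball_mem_nhds 1 two_pos)
      have h0 : Unitary.argSelfAdjoint (1 : Matrix.unitaryGroup (Fin 2) ℂ) = 0 := by
        have := argSelfAdjoint_expUnitary (A := Matrix (Fin 2) (Fin 2) ℂ) (x := 0)
          (by simpa using Real.pi_pos)
        rwa [selfAdjoint.expUnitary_zero] at this
      refine hc.norm.eventually_lt_const ?_
      simp only [h0, norm_zero]
      positivity
  obtain ⟨m, hm⟩ := exists_uniform_pow_mem (G := Fin n → Matrix.unitaryGroup (Fin 2) ℂ)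
    (O := Set.univ.pi fun _ => O) (set_pi_mem_nhds Set.finite_univ fun _ _ => hO)
  -- The first factor kills every permutation; `m.factorial` is a multiple of every recurrence time
  -- `q ≤ m`, so the exponent does not depend on `V`.
  refine ⟨Fintype.card (Equiv.Perm (Fin n)) * m.factorial,
    mul_pos Fintype.card_pos m.factorial_pos, fun V hV => ?_⟩
  obtain ⟨hV, π, U, hU⟩ := hV
  obtain ⟨W, hW⟩ := pow_eq_permOp_mul_tensor hU (Fintype.card (Equiv.Perm (Fin n)))
  rw [pow_card_eq_one, permOp_one, one_mul] at hW
  obtain ⟨q, hq, hqm, hWq⟩ := hm W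
  obtain ⟨r, hr⟩ := Nat.dvd_factorial hq hqm
  have hcomm : Commute (tensor fun i => (W i : Matrix (Fin 2) (Fin 2) ℂ)) S.proj :=
    hW ▸ (show Commute (V : Op n) S.proj from hV).pow_left _
  have hWq' : (tensor fun i => ((W ^ q) i : Matrix (Fin 2) (Fin 2) ℂ)) =
      (tensor fun i => (W i : Matrix (Fin 2) (Fin 2) ℂ)) ^ q := by
    rw [tensor_pow]; rfl
  obtain ⟨a, ha, h⟩ := exists_mem_siteAlg_of_norm_lt (S := S) (U := W ^ q)
    (fun j => (hWq j trivial).1) (fun j => (hWq j trivial).2) (hWq' ▸ hcomm.pow_left q)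
  refine ⟨a ^ r, pow_mem ha r, ?_⟩
  rw [pow_mul, hW, hr, pow_mul, ← hWq']
  exact pow_mul_proj ha h r

theorem LogicalPaulis.EncodedUniversalFor.exists_pow_mem_closure [Finite S.group] {k : ℕ}
    {L : S.LogicalPaulis k} {s : Fin k} (h : L.EncodedUniversalFor s S.aut) :
    ∃ M : ℕ, 0 < M ∧ ∀ U ∈ S.logicalGates, L.ActsOnlyOn s U →
      (U : Op n) ^ M * S.proj ∈ closure ((· * S.proj) '' (S.siteAlg : Set (Op n))) := by
  obtain ⟨M, hM, hpow⟩ := exists_pow_mul_proj_mem (S := S)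
  refine ⟨M, hM, fun U hU hUs => ?_⟩
  -- Positivity of `M` is needed here: the zeroth power of the projector is `1`.
  have hP : ∀ T : Op n, Commute T S.proj → (T * S.proj) ^ M = T ^ M * S.proj := fun T hT => by
    have : IsIdempotentElem S.proj := S.proj_mul_self
    rw [hT.mul_pow, this.pow_eq hM.ne']
  have hcl : (U : Op n) * S.proj ∈ closure ((fun V : Gate n => (V : Op n) * S.proj) '' S.aut) := by
    refine Metric.mem_closure_iff.2 fun ε hε => ?_
    obtain ⟨Vs, hVs, hd⟩ := h U hU hUs ε hε
    exact ⟨_, ⟨_, list_prod_mem_aut hVs, rfl⟩, by rwa [dist_eq_norm]⟩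
  rw [← hP _ hU.2]
  refine map_mem_closure (f := fun T : Op n => T ^ M) (by fun_prop) hcl ?_
  rintro _ ⟨V, hV, rfl⟩
  obtain ⟨a, ha, e⟩ := hpow V hV
  exact ⟨a, ha, ((hP _ hV.1).trans e).symm⟩

theorem FreeOfTriviallyEncodedQubits.commute_of_mem_closure
    (hS : S.FreeOfTriviallyEncodedQubits) {A B : Op n}
    (hA : A ∈ closure ((· * S.proj) '' (S.siteAlg : Set (Op n))))
    (hB : B ∈ closure ((· * S.proj) '' (S.siteAlg : Set (Op n)))) : A * B = B * A := by
  have hclosed : IsClosed {p : Op n × Op n | p.1 * p.2 = p.2 * p.1} :=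
    isClosed_eq (by fun_prop) (by fun_prop)
  have hAB : (A, B) ∈ closure (((· * S.proj) '' (S.siteAlg : Set (Op n))) ×ˢ
      ((· * S.proj) '' (S.siteAlg : Set (Op n)))) := by
    rw [closure_prod_eq]; exact ⟨hA, hB⟩
  refine closure_minimal ?_ hclosed hAB
  rintro ⟨_, _⟩ ⟨⟨a, ha, rfl⟩, ⟨b, hb, rfl⟩⟩
  have h1 := commute_proj_of_mem_siteAlg ha
  have h2 := commute_proj_of_mem_siteAlg hb
  exact (Commute.mul_left (Commute.mul_right (hS.commute ha hb) h1.symm)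
    (Commute.mul_right h2 (Commute.refl _))).eq

end Stabilizer

/-! ### Rotations as logical gates. -/

/-- The rotation `exp (iθX) = cos θ + i sin θ X` about an involution `X`. -/
def rotation {n : ℕ} (X : Op n) (θ : ℝ) : Op n :=
  (Real.cos θ : ℂ) • 1 + (Complex.I * Real.sin θ) • X

theorem rotation_mul {n : ℕ} {X : Op n} (hX : X * X = 1) (a b : ℝ) :
    rotation X a * rotation X b = rotation X (a + b) := by
  simp only [rotation, Real.cos_add, Real.sin_add, add_mul, mul_add, smul_mul_smul_comm, hX,
    one_mul, mul_one]
  have : Complex.I * (Real.sin a : ℂ) * (Complex.I * Real.sin b) = - (Real.sin a * Real.sin b) := by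
    linear_combination (Real.sin a * Real.sin b : ℂ) * Complex.I_mul_I
  rw [this]
  push_cast
  module

theorem rotation_zero {n : ℕ} (X : Op n) : rotation X 0 = 1 := by
  simp [rotation]

theorem rotation_pow {n : ℕ} {X : Op n} (hX : X * X = 1) (θ : ℝ) (m : ℕ) :
    rotation X θ ^ m = rotation X (m * θ) := by
  induction m with
  | zero => simp [rotation_zero]
  | succ m ih =>
    rw [pow_succ, ih, rotation_mul hX]
    congr 1; push_cast; ring

theorem rotation_pi_div_two {n : ℕ} (X : Op n) : rotation X (Real.pi / 2) = Complex.I • X := by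
  simp [rotation]

theorem star_rotation {n : ℕ} {X : Op n} (hX : star X = X) (θ : ℝ) :
    star (rotation X θ) = rotation X (-θ) := by
  simp [rotation, hX, -Complex.ofReal_cos, -Complex.ofReal_sin]

theorem commute_rotation {n : ℕ} {X Y : Op n} (h : Commute X Y) (θ : ℝ) :
    Commute (rotation X θ) Y :=
  ((Commute.one_left _).smul_left _).add_left (h.smul_left _)

theorem star_eq_self_of_mul_self {n : ℕ} {X : Gate n} (hX : X * X = 1) :
    star (X : Op n) = X := by
  have : X⁻¹ = X := inv_eq_of_mul_eq_one_left hX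
  exact congrArg Subtype.val this

/-- Conjugation by the anticommuting `Y` reverses the angle, so opposite angles give equal
determinants. Splitting `θ` into halves and reversing one of them gives the determinant of the
identity. -/
theorem det_rotation {n : ℕ} {X Y : Gate n} (hX : X * X = 1) (hXY : X * Y = -(Y * X)) (θ : ℝ) :
    (rotation (X : Op n) θ).det = 1 := by
  have hX' : (X : Op n) * X = 1 := congrArg Subtype.val hX
  have hXY' : (X : Op n) * Y = -(Y * X) := congrArg Subtype.val hXY
  have hY : (star (Y : Op n)) * Y = 1 := Unitary.star_mul_self_of_mem Y.2
  have key : ∀ t : ℝ, (rotation (X : Op n) t).det = (rotation (X : Op n) (-t)).det := fun t => by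
    have h : rotation (X : Op n) t * Y = Y * rotation (X : Op n) (-t) := by
      simp [rotation, add_mul, mul_add, hXY']
    have h1 := congrArg Matrix.det (congrArg (star (Y : Op n) * ·) h)
    have h2 := congrArg Matrix.det hY
    simp only [Matrix.det_mul, Matrix.det_one] at h1 h2
    linear_combination h1 + (-(rotation (X : Op n) t).det + (rotation (X : Op n) (-t)).det) * h2
  have h : θ = θ / 2 + θ / 2 := by ring
  rw [h, ← rotation_mul hX', Matrix.det_mul]
  nth_rw 2 [key]
  rw [← Matrix.det_mul, rotation_mul hX', add_neg_cancel, rotation_zero, Matrix.det_one]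

/-- The rotation `exp (iθX)` about a Hermitian unitary `X`, as a gate. -/
def rotationGate {n : ℕ} (X : Gate n) (hX : X * X = 1) (θ : ℝ) : Gate n :=
  ⟨rotation X θ, by
    have hX' : (X : Op n) * X = 1 := congrArg Subtype.val hX
    refine Unitary.mem_iff.2 ⟨?_, ?_⟩ <;>
      rw [star_rotation (star_eq_self_of_mul_self hX), rotation_mul hX'] <;> simp [rotation_zero]⟩

/-! ### The contradiction from anticommuting logical Paulis. -/

namespace Stabilizer

variable {n : ℕ} {S : Stabilizer n}

theorem commute_proj_of_centralizes {X : Gate n} (h : ∀ R ∈ S.group, X * R = R * X) :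
    Commute (X : Op n) S.proj :=
  S.commute_proj fun R hR => congrArg Subtype.val (h R hR).symm

theorem rotationGate_mem_logicalGates {X Y : Gate n} (hX : X * X = 1) (hXY : X * Y = -(Y * X))
    (h : ∀ R ∈ S.group, X * R = R * X) (θ : ℝ) : rotationGate X hX θ ∈ S.logicalGates :=
  ⟨det_rotation hX hXY θ, (commute_rotation (commute_proj_of_centralizes h) θ).eq⟩

theorem LogicalPaulis.actsOnlyOn_rotationGate {k : ℕ} {L : S.LogicalPaulis k} {s : Fin k}
    {X : Gate n} (hX : X * X = 1)
    (h : ∀ t, t ≠ s → X * L.X t = L.X t * X ∧ X * L.Z t = L.Z t * X) (θ : ℝ) :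
    L.ActsOnlyOn s (rotationGate X hX θ) := fun t ht =>
  ⟨congrArg (· * S.proj) (commute_rotation (congrArg Subtype.val (h t ht).1) θ).eq,
    congrArg (· * S.proj) (commute_rotation (congrArg Subtype.val (h t ht).2) θ).eq⟩

theorem LogicalPaulis.not_encodedUniversalFor_aut {k : ℕ} (hk : S.HasLogicalQubits k)
    (hS : S.FreeOfTriviallyEncodedQubits) (L : S.LogicalPaulis k) (s : Fin k) :
    ¬ L.EncodedUniversalFor s S.aut := by
  intro h
  have := hk.finite
  obtain ⟨M, hM, hcl⟩ := h.exists_pow_mem_closure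
  -- The angle is chosen so that the `M`-th power of the rotation is `Complex.I • X`.
  have hM' : (M : ℝ) * (Real.pi / 2 / M) = Real.pi / 2 :=
    mul_div_cancel₀ _ (Nat.cast_ne_zero.2 hM.ne')
  have key : ∀ {X Y : Gate n} (hX : X * X = 1), X * Y = -(Y * X) →
      (∀ R ∈ S.group, X * R = R * X) →
      (∀ t, t ≠ s → X * L.X t = L.X t * X ∧ X * L.Z t = L.Z t * X) →
      Complex.I • (X : Op n) * S.proj ∈ closure ((· * S.proj) '' (S.siteAlg : Set (Op n))) := by
    intro X Y hX hXY hR ht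
    have := hcl _ (rotationGate_mem_logicalGates hX hXY hR (Real.pi / 2 / M))
      (LogicalPaulis.actsOnlyOn_rotationGate hX ht _)
    rwa [rotationGate, rotation_pow (congrArg Subtype.val hX), hM', rotation_pi_div_two] at this
  have hanti := L.XZ_anticomm s
  have h1 := key (L.X_sq s) hanti (L.X_centralizes s)
    fun t ht => ⟨L.X_comm s t, L.XZ_comm s t ht.symm⟩
  have h2 := key (L.Z_sq s) (by rw [hanti, neg_neg]) (L.Z_centralizes s)
    fun t ht => ⟨(L.XZ_comm t s ht).symm, L.Z_comm s t⟩
  have hc := hS.commute_of_mem_closure h1 h2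
  have hXP := commute_proj_of_centralizes (L.X_centralizes s)
  have hZP := commute_proj_of_centralizes (L.Z_centralizes s)
  have hXZ : (L.X s : Op n) * L.Z s = -(L.Z s * L.X s) := congrArg Subtype.val hanti
  have hXX : (L.X s : Op n) * L.X s = 1 := congrArg Subtype.val (L.X_sq s)
  have hZZ : (L.Z s : Op n) * L.Z s = 1 := congrArg Subtype.val (L.Z_sq s)
  have e : ∀ A B : Op n, Commute B S.proj →
      Complex.I • A * S.proj * (Complex.I • B * S.proj) = -(A * B * S.proj) := by
    intro A B hB
    rw [smul_mul_assoc Complex.I A, smul_mul_assoc Complex.I B, smul_mul_smul_comm,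
      Complex.I_mul_I, neg_one_smul, mul_assoc A, ← mul_assoc S.proj, ← hB.eq, mul_assoc B, S.proj_mul_self, mul_assoc]
  rw [e _ _ hZP, e _ _ hXP, hXZ, neg_mul, neg_neg] at hc
  -- On the code the two products both commute and anticommute, hence vanish; the logical Paulis
  -- being involutions, the projector would vanish too.
  have h0 : (L.Z s : Op n) * L.X s * S.proj = 0 := by
    have := congrArg ((2⁻¹ : ℂ) • ·) (eq_neg_iff_add_eq_zero.1 hc)
    simpa [← two_smul ℂ] using this
  apply proj_ne_zero (S := S)
  calc S.proj = L.X s * (L.Z s * L.Z s * L.X s) * S.proj := by rw [hZZ, one_mul, hXX, one_mul]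
    _ = L.X s * (L.Z s * (L.Z s * L.X s * S.proj)) := by simp only [mul_assoc]
    _ = 0 := by rw [h0, mul_zero, mul_zero]

end Stabilizer

end StabCode

end

theorem mainTheorem2 {n k : ℕ} (S : StabCode.Stabilizer n) (hk : S.HasLogicalQubits k)
    (hS : S.FreeOfTriviallyEncodedQubits) (L : S.LogicalPaulis k) (s : Fin k) :
    ¬ L.EncodedUniversalFor s S.aut := by
  exact StabCode.Stabilizer.LogicalPaulis.not_encodedUniversalFor_aut hk hS L s
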